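/- Let $R$ be a commutative noetherian local ring with maximal ideal $\mathfrak m$, residue field $k=R/\mathfrak m$ and $\mathfrak m$-adic completion $\widehat R$. An $R$-module $L$ is called mini-max if it has a noetherian submodule $N\subseteq L$ such that $L/N$ is artinian. It is called Matlis reflexive over $R$ if the natural biduality map $L\to\operatorname{Hom}_R(\operatorname{Hom}_R(L,E),E)$, $x\mapsto(\psi\mapsto\psi(x))$, is an isomorphism, where $E=E_R(k)$ is the injective hull of $k$; Matlis reflexivity over the local ring $\widehat R$ is defined in the same way, using the injective hull over $\widehat R$ of the residue field of $\widehat R$. Let $M$ and $M'$ be mini-max $R$-modules, and let $i\ge 0$. (a) The $R$-module $\operatorname{Tor}_i^R(M,M')$ is mini-max. (b) If the ring $R/(\operatorname{Ann}_R(M)+\operatorname{Ann}_R(M'))$ is complete (with respect to the image of $\mathfrak m$), then $\operatorname{Tor}_i^R(M,M')$ is Matlis reflexive over $R$, it has a unique $\widehat R$-module structure compatible with its $R$-module structure, and with this structure it is Matlis reflexive over $\widehat R$. (c) If the ring $R/(\operatorname{Ann}_R(M)+\operatorname{Ann}_R(M'))$ is artinian, then $\operatorname{Tor}_i^R(M,M')$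 has finite length over $R$. (The zero ring counts as complete and as artinian.) -/

import Mathlib

open CategoryTheory IsLocalRing

universe u

/-! ## Mini-max modules -/

/-- A module is mini-max if it has a noetherian submodule with artinian quotient. -/
def IsMiniMax (R : Type*) [CommRing R] (M : Type*) [AddCommGroup M] [Module R M] : Prop :=
  ∃ N : Submodule R M, IsNoetherian R N ∧ IsArtinian R (M ⧸ N)

/-! ## Injective hulls -/

/-- `f : M → E` is an injective hull of `M`: `f` is an essential monomorphism into an
injective module. -/
structure IsInjectiveHull {R : Type u} [CommRing R] {M E : Type u} [AddCommGroup M] [Module R M]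
    [AddCommGroup E] [Module R E] (f : M →ₗ[R] E) : Prop where
  module_injective : Module.Injective R E
  map_injective : Function.Injective f
  essential : ∀ K : Submodule R E, K ⊓ LinearMap.range f = ⊥ → K = ⊥

/-- If a submodule `E` of an injective module `I` has no proper essential extension inside `I`,
then `E` is itself injective. -/
theorem injective_of_maximal_essential {R : Type u} [CommRing R] {I : Type u}
    [AddCommGroup I] [Module R I] (hI : Module.Injective R I) (E : Submodule R I)
    (hmax : ∀ F : Submodule R I, E ≤ F →
      (∀ K : Submodule R I, K ≤ F → K ⊓ E = ⊥ → K = ⊥) → F = E) :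
    Module.Injective R E := by
  -- choose a maximal `C` with `C ⊓ E = ⊥`
  obtain ⟨C, -, hC⟩ := zorn_le_nonempty₀ {C : Submodule R I | C ⊓ E = ⊥} (by
    intro c hc hchain y hy
    refine ⟨sSup c, ?_, fun z hz => le_sSup hz⟩
    change sSup c ⊓ E = ⊥
    rw [eq_bot_iff]
    rintro x ⟨hx, hxE⟩
    obtain ⟨z, hz, hxz⟩ := (Submodule.mem_sSup_of_directed ⟨y, hy⟩ hchain.directedOn).1 hx
    have h0 : x ∈ z ⊓ E := ⟨hxz, hxE⟩
    rwa [show z ⊓ E = ⊥ from hc hz] at h0) ⊥ (by simp)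
  have hCE : C ⊓ E = ⊥ := hC.prop
  have hq : Function.Injective (C.mkQ ∘ₗ E.subtype) := by
    rw [← LinearMap.ker_eq_bot, LinearMap.ker_eq_bot']
    intro x hx
    have hxC : (x : I) ∈ C := by simpa using hx
    have h0 : (x : I) ∈ C ⊓ E := ⟨hxC, x.2⟩
    rw [hCE] at h0
    exact Subtype.ext (by simpa using h0)
  obtain ⟨h, hh⟩ := hI.out (C.mkQ ∘ₗ E.subtype) hq E.subtype
  have hh' : ∀ x ∈ E, h (C.mkQ x) = x := fun x hx => hh ⟨x, hx⟩
  -- `h` is injective, because `E → I ⧸ C` is essential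
  have hker : ∀ y : I, h (C.mkQ y) = 0 → y ∈ C := by
    intro y hy
    have hD : (C ⊔ Submodule.span R {y}) ⊓ E = ⊥ := by
      rw [eq_bot_iff]
      rintro x ⟨hx, hxE⟩
      obtain ⟨c, hc, z, hz, rfl⟩ := Submodule.mem_sup.1 hx
      obtain ⟨r, rfl⟩ := Submodule.mem_span_singleton.1 hz
      have h1 := hh' _ hxE
      have hc0 : C.mkQ c = 0 := by simpa using hc
      rw [map_add, map_smul, hc0, zero_add, map_smul, hy, smul_zero] at h1
      simp [← h1]
    have hle := hC.le_of_ge (y := C ⊔ Submodule.span R {y}) hD le_sup_left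
    exact hle (Submodule.mem_sup_right (Submodule.mem_span_singleton_self y))
  -- the range of `h` is an essential extension of `E`
  have hrange : LinearMap.range h = E := by
    apply hmax
    · intro x hx
      exact ⟨_, hh' x hx⟩
    · intro K hK hKE
      have hP : C ≤ K.comap (h ∘ₗ C.mkQ) := by
        intro c hc
        have hc0 : C.mkQ c = 0 := by simpa using hc
        simp [-Submodule.mkQ_apply, hc0]
      have hPE : K.comap (h ∘ₗ C.mkQ) ⊓ E = ⊥ := by
        rw [eq_bot_iff]
        rintro x ⟨hx, hxE⟩
        have hx' : h (C.mkQ x) ∈ K := hx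
        rw [hh' x hxE] at hx'
        have h0 : x ∈ K ⊓ E := ⟨hx', hxE⟩
        rwa [hKE] at h0
      have hle := hC.le_of_ge (y := K.comap (h ∘ₗ C.mkQ)) hPE hP
      rw [eq_bot_iff]
      intro k hk
      obtain ⟨q, rfl⟩ := hK hk
      obtain ⟨y, rfl⟩ := C.mkQ_surjective q
      have hyC : y ∈ C := hle hk
      have hc0 : C.mkQ y = 0 := by simpa using hyC
      simp [-Submodule.mkQ_apply, hc0]
  -- hence `E` is a retract of `I`
  let p : I →ₗ[R] E := LinearMap.codRestrict E (h ∘ₗ C.mkQ) fun x => by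
    rw [← hrange]; exact ⟨_, rfl⟩
  have hp : ∀ x : E, p x = x := fun x => Subtype.ext (hh' x x.2)
  refine ⟨fun X Y _ _ _ _ f hf g => ?_⟩
  obtain ⟨g', hg'⟩ := hI.out f hf (E.subtype ∘ₗ g)
  exact ⟨p ∘ₗ g', fun x => by
    rw [LinearMap.comp_apply, hg', LinearMap.comp_apply]
    exact hp _⟩

/-- Every module has an injective hull. -/
theorem exists_isInjectiveHull (R : Type u) [CommRing R] (M : Type u) [AddCommGroup M]
    [Module R M] : ∃ (E : ModuleCat.{u} R) (f : M →ₗ[R] E), IsInjectiveHull f := by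
  -- embed `M` into an injective module `I`
  let I : ModuleCat.{u} R := Injective.under (ModuleCat.of R M)
  have hI : Module.Injective R I :=
    (Module.injective_iff_injective_object R I).2
      (inferInstanceAs (Injective (Injective.under (ModuleCat.of R M))))
  let i : M →ₗ[R] I := (Injective.ι (ModuleCat.of R M)).hom
  have hi : Function.Injective i :=
    (ModuleCat.mono_iff_injective (Injective.ι (ModuleCat.of R M))).1 inferInstance
  -- take a maximal essential extension of the image of `M` inside `I`
  obtain ⟨E, hiE, hE⟩ := zorn_le_nonempty₀
    {E : Submodule R I | ∀ K : Submodule R I, K ≤ E → K ⊓ LinearMap.range i = ⊥ → K = ⊥} (by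
      intro c hc hchain y hy
      refine ⟨sSup c, ?_, fun z hz => le_sSup hz⟩
      intro K hK hKi
      rw [eq_bot_iff]
      intro x hx
      obtain ⟨z, hz, hxz⟩ :=
        (Submodule.mem_sSup_of_directed ⟨y, hy⟩ hchain.directedOn).1 (hK hx)
      have h0 : K ⊓ z = ⊥ := hc hz _ inf_le_right
        (eq_bot_iff.2 (hKi ▸ inf_le_inf_right _ inf_le_left))
      rw [← h0]
      exact ⟨hx, hxz⟩) (LinearMap.range i) (by
      intro K hK hKi
      rwa [inf_eq_left.2 hK] at hKi)
  have hess : ∀ K : Submodule R I, K ≤ E → K ⊓ LinearMap.range i = ⊥ → K = ⊥ := hE.prop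
  let f : M →ₗ[R] E := LinearMap.codRestrict E i fun x => hiE ⟨x, rfl⟩
  refine ⟨ModuleCat.of R E, f, ?_, ?_, ?_⟩
  · refine injective_of_maximal_essential hI E fun F hEF hF => le_antisymm ?_ hEF
    refine hE.le_of_ge (y := F) (fun K hK hKi => hF K hK ?_) hEF
    exact hess _ inf_le_right (eq_bot_iff.2 (hKi ▸ inf_le_inf_right _ inf_le_left))
  · intro x y hxy
    exact hi (congrArg Subtype.val hxy)
  · intro K hK
    have h0 := hess (K.map E.subtype) (Submodule.map_subtype_le E K) (by
      rw [eq_bot_iff]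
      rintro _ ⟨⟨k, hk, rfl⟩, m, hm⟩
      have hkm : f m = k := Subtype.ext hm
      have h1 : k ∈ K ⊓ LinearMap.range f := ⟨hk, m, hkm⟩
      rw [hK] at h1
      have h2 : k = 0 := h1
      simp [h2])
    exact Submodule.map_injective_of_injective E.injective_subtype (by rw [h0, Submodule.map_bot])

/-! ## Matlis duality over a local ring -/

/-- The injective hull `E_R(k)` of the residue field `k` of a local ring `R`. -/
noncomputable def matlisModule (R : Type u) [CommRing R] [IsLocalRing R] : ModuleCat.{u} R :=
  (exists_isInjectiveHull R (ResidueField R)).choose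

/-- The embedding of the residue field into its injective hull. -/
noncomputable def matlisModuleEmbedding (R : Type u) [CommRing R] [IsLocalRing R] :
    ResidueField R →ₗ[R] matlisModule R :=
  (exists_isInjectiveHull R (ResidueField R)).choose_spec.choose

theorem isInjectiveHull_matlisModuleEmbedding (R : Type u) [CommRing R] [IsLocalRing R] :
    IsInjectiveHull (matlisModuleEmbedding R) :=
  (exists_isInjectiveHull R (ResidueField R)).choose_spec.choose_spec

/-- The Matlis dual `Hom_R(M, E_R(k))`. -/
abbrev MatlisDual (R : Type u) [CommRing R] [IsLocalRing R] (M : Type u) [AddCommGroup M]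
    [Module R M] : Type u :=
  M →ₗ[R] matlisModule R

/-- The natural biduality map `M → Hom_R(Hom_R(M, E), E)`, `x ↦ (ψ ↦ ψ x)`. -/
noncomputable def matlisBiduality (R : Type u) [CommRing R] [IsLocalRing R] (M : Type u)
    [AddCommGroup M] [Module R M] : M →ₗ[R] MatlisDual R (MatlisDual R M) :=
  LinearMap.flip LinearMap.id

theorem matlisBiduality_apply (R : Type u) [CommRing R] [IsLocalRing R] (M : Type u)
    [AddCommGroup M] [Module R M] (x : M) (ψ : MatlisDual R M) :
    matlisBiduality R M x ψ = ψ x := rfl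

/-- A module is Matlis reflexive if its natural biduality map is an isomorphism. -/
def IsMatlisReflexive (R : Type u) [CommRing R] [IsLocalRing R] (M : Type u)
    [AddCommGroup M] [Module R M] : Prop :=
  Function.Bijective (matlisBiduality R M)

/-- The completion of a local ring with respect to its maximal ideal. -/
abbrev LocalCompletion (R : Type u) [CommRing R] [IsLocalRing R] : Type u :=
  AdicCompletion (maximalIdeal R) R

/-- The `R`-module `L` is Matlis reflexive over the completion of `R`: there is exactly one module
structure over the completion that is compatible with the `R`-module structure of `L`, and `L` is
Matlis reflexive for this structure. -/
def IsMatlisReflexiveOverCompletion (R : Type u) [CommRing R] [IsNoetherianRing R] [IsLocalRing R]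
    (L : Type u) [AddCommGroup L] [Module R L] : Prop :=
  (∃! _inst : Module (LocalCompletion R) L, IsScalarTower R (LocalCompletion R) L) ∧
    ∀ [Module (LocalCompletion R) L] [IsScalarTower R (LocalCompletion R) L],
      IsMatlisReflexive (LocalCompletion R) L

/-- For an ideal `a` of a local ring `R`, the ring `R ⧸ a` is complete, with respect to the image
of the maximal ideal of `R` (the zero ring counts as complete). -/
def IsCompleteQuotient (R : Type u) [CommRing R] [IsLocalRing R] (a : Ideal R) : Prop :=
  IsAdicComplete ((maximalIdeal R).map (Ideal.Quotient.mk a)) (R ⧸ a)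

/-! ## Tor -/

/-- The `R`-module `Tor_i^R(M, M')`. -/
noncomputable abbrev torModule (R : Type u) [CommRing R] (i : ℕ) (M M' : Type u) [AddCommGroup M]
    [Module R M] [AddCommGroup M'] [Module R M'] : ModuleCat.{u} R :=
  ((Tor (ModuleCat.{u} R) i).obj (ModuleCat.of R M)).obj (ModuleCat.of R M')

/-! Mini-max, artinian and Matlis reflexive modules each form a Serre class, so a mini-max `M` can
be treated through a noetherian `N` with `M ⧸ N` artinian.

For finitely generated `N`, dimension shifting puts `Tor_i(N, M')` in every Serre class containing
`M'`; in particular it is mini-max. For artinian `A`, `Tor_i(A, M')` is even artinian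
(`isArtinian_torHomology`), by induction on generators of the maximal ideal: the kernel of a
generator `x` on `Tor_i(A, M')` is squeezed between images of `Tor_i(ker x, M')` and
`Tor_{i+1}(A/xA, M')`. Powers of `x` kill each element of Tor, so
`isArtinian_of_isArtinian_ker_smul` concludes. The long exact sequence then gives (a).

Tor is killed by `a = Ann M + Ann M'`, so (c) follows from Hopkins–Levitzki. For (b), mini-max
modules killed by `b` are reflexive over a local ring `S` whenever `S ⧸ b` is noetherian and
precomplete (`IsMiniMax.isMatlisReflexive`): finitely generated ones reduce to `S ⧸ b`, and artinian
ones embed in a finite power of its dual. This is applied to `R` with `a`, and to the completion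
with the extension of `a`; both quotients are the same ring, which also yields the unique module
structure. -/

/-! ### Serre classes of modules -/

/-- A class of modules is a Serre class if it contains the zero modules and is closed under
middle terms of exact sequences. -/
structure IsSerreClass (R : Type u) [CommRing R]
    (P : ∀ (M : Type u) [AddCommGroup M] [Module R M], Prop) : Prop where
  of_subsingleton : ∀ (M : Type u) [AddCommGroup M] [Module R M] [Subsingleton M], P M
  of_exact : ∀ {A B C : Type u} [AddCommGroup A] [Module R A] [AddCommGroup B] [Module R B]
    [AddCommGroup C] [Module R C] (f : A →ₗ[R] B) (g : B →ₗ[R] C), Function.Exact f g →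
    P A → P C → P B

namespace IsSerreClass

variable {R : Type u} [CommRing R] {P : ∀ (M : Type u) [AddCommGroup M] [Module R M], Prop}
  {A B : Type u} [AddCommGroup A] [Module R A] [AddCommGroup B] [Module R B]

theorem of_injective (hP : IsSerreClass R P) (f : A →ₗ[R] B) (hf : Function.Injective f)
    (hB : P B) : P A :=
  hP.of_exact (0 : PUnit.{u + 1} →ₗ[R] A) f
    (fun x => by simp [map_eq_zero_iff f hf, eq_comm])
    (hP.of_subsingleton _) hB

theorem of_surjective (hP : IsSerreClass R P) (f : A →ₗ[R] B) (hf : Function.Surjective f)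
    (hA : P A) : P B :=
  hP.of_exact f (0 : B →ₗ[R] PUnit.{u + 1}) (fun x => by simpa using hf x) hA
    (hP.of_subsingleton _)

theorem of_submodule_quotient (hP : IsSerreClass R P) (N : Submodule R A) (hN : P N)
    (hQ : P (A ⧸ N)) : P A :=
  hP.of_exact N.subtype N.mkQ (LinearMap.exact_subtype_mkQ N) hN hQ

theorem pi_fin (hP : IsSerreClass R P) (hA : P A) (n : ℕ) : P (Fin n → A) := by
  induction n with
  | zero => exact hP.of_subsingleton _
  | succ n ih =>
    refine hP.of_exact (LinearMap.single R (fun _ : Fin (n + 1) => A) 0)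
      (LinearMap.funLeft R A (Fin.succ : Fin n → Fin (n + 1))) (fun y => ?_) hA ih
    constructor
    · intro hy
      refine ⟨y 0, ?_⟩
      ext j
      refine Fin.cases ?_ (fun j => ?_) j
      · simp
      · simpa using (congrFun hy j).symm
    · rintro ⟨a, rfl⟩
      ext j
      simp [LinearMap.funLeft_apply]

theorem pi (hP : IsSerreClass R P) (hA : P A) (ι : Type*) [Finite ι] (f : B →ₗ[R] ι → A)
    (hf : Function.Injective f) : P B := by
  obtain ⟨n, ⟨e⟩⟩ := Finite.exists_equiv_fin ι
  exact hP.of_injective ((LinearEquiv.funCongrLeft R A e.symm).toLinearMap ∘ₗ f)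
    ((LinearEquiv.funCongrLeft R A e.symm).injective.comp hf) (hP.pi_fin hA n)

/-- Choosing `n` generators makes `A` a quotient of `(R ⧸ I)^n`. -/
theorem of_finite_of_annihilated (hP : IsSerreClass R P) (I : Ideal R) (hI : P (R ⧸ I))
    [Module.Finite R A] (hA : ∀ r ∈ I, ∀ a : A, r • a = 0) : P A := by
  obtain ⟨n, s, hs⟩ := Module.Finite.exists_fin (R := R) (M := A)
  have hle : ∀ i, I ≤ LinearMap.ker (LinearMap.toSpanSingleton R A (s i)) := fun i r hr => by
    simpa using hA r hr (s i)
  refine hP.of_surjective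
    (LinearMap.lsum R (fun _ : Fin n => R ⧸ I) ℕ fun i =>
      Submodule.liftQ I (LinearMap.toSpanSingleton R A (s i)) (hle i)) ?_ (hP.pi_fin hI n)
  rw [← LinearMap.range_eq_top, eq_top_iff, ← hs, Submodule.span_le]
  rintro _ ⟨i, rfl⟩
  refine ⟨Pi.single i (Ideal.Quotient.mk I 1), ?_⟩
  rw [LinearMap.lsum_piSingle]
  exact (Submodule.liftQ_apply I _ 1).trans (one_smul R (s i))

end IsSerreClass

/-! ### Mini-max modules and finite length -/

section MiniMax

theorem isSerreClass_isArtinian (R : Type u) [CommRing R] :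
    IsSerreClass R fun M _ _ => IsArtinian R M where
  of_subsingleton _ _ _ _ := inferInstance
  of_exact f g hfg _ _ :=
    isArtinian_of_range_eq_ker f g (LinearMap.exact_iff.1 hfg).symm

/-- The noetherian submodule of `B` is the image of `N` enlarged by lifts `F` of finitely many
generators of `range g ⊓ N'`. The lifts make the induced sequence of quotients exact in the middle.
-/
theorem isSerreClass_isMiniMax (R : Type u) [CommRing R] [IsNoetherianRing R] :
    IsSerreClass R fun M _ _ => IsMiniMax R M where
  of_subsingleton _ _ _ _ := ⟨⊥, inferInstance, inferInstance⟩
  of_exact {A B C} _ _ _ _ _ _ f g hfg := by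
    rintro ⟨N, hN, hAN⟩ ⟨N', hN', hCN'⟩
    have hG : (LinearMap.range g ⊓ N').FG :=
      (isNoetherian_submodule.1 hN') _ inf_le_right
    obtain ⟨F, hF, hFG⟩ : ∃ F : Submodule R B, F.FG ∧ F.map g = LinearMap.range g ⊓ N' := by
      obtain ⟨s, hs⟩ := hG
      have h : ∀ y ∈ s, ∃ b, g b = y := fun y hy =>
        (show y ∈ LinearMap.range g ⊓ N' from hs ▸ Submodule.subset_span hy).1
      choose! l hl using h
      refine ⟨Submodule.span R (l '' s), Submodule.fg_span (s.finite_toSet.image l), ?_⟩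
      rw [Submodule.map_span, Set.image_image, ← hs]
      exact congrArg _ ((Set.image_congr hl).trans (Set.image_id' _))
    have hNfg : N.FG := Module.Finite.iff_fg.1 inferInstance
    have hg0 : ∀ a, g (f a) = 0 := hfg.apply_apply_eq_zero
    refine ⟨N.map f ⊔ F, isNoetherian_of_fg_of_noetherian _ ((hNfg.map f).sup hF), ?_⟩
    have h1 : N ≤ (N.map f ⊔ F).comap f := fun x hx =>
      Submodule.mem_sup_left ⟨x, hx, rfl⟩
    have h2 : N.map f ⊔ F ≤ N'.comap g := by
      rw [sup_le_iff]
      constructor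
      · rintro _ ⟨a, -, rfl⟩
        simp [hg0]
      · intro x hx
        have : g x ∈ F.map g := ⟨x, hx, rfl⟩
        rw [hFG] at this
        exact this.2
    refine isArtinian_of_range_eq_ker (N.mapQ _ f h1) (Submodule.mapQ _ N' g h2)
      (le_antisymm ?_ ?_)
    · rintro _ ⟨a, rfl⟩
      obtain ⟨a, rfl⟩ := Submodule.Quotient.mk_surjective _ a
      simp [hg0]
    · intro b hb
      obtain ⟨b, rfl⟩ := Submodule.Quotient.mk_surjective _ b
      have hb' : g b ∈ N' := by simpa using hb
      have : g b ∈ F.map g := by rw [hFG]; exact ⟨⟨b, rfl⟩, hb'⟩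
      obtain ⟨y, hy, hyb⟩ := this
      obtain ⟨a, ha⟩ := (hfg (b - y)).1 (by simp [hyb])
      refine ⟨Submodule.Quotient.mk a, ?_⟩
      rw [Submodule.mapQ_apply, ha, Submodule.Quotient.eq]
      exact Submodule.mem_sup_right (by simpa using hy)

theorem IsMiniMax.of_isArtinian {R M : Type*} [CommRing R] [AddCommGroup M] [Module R M]
    [IsArtinian R M] : IsMiniMax R M :=
  ⟨⊥, inferInstance, inferInstance⟩

/-- `R` and `R ⧸ I` have the same submodules in `M`, and Hopkins–Levitzki applies over the artinian
ring `R ⧸ I`. -/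
theorem isNoetherian_iff_isArtinian_of_annihilated {R M : Type*} [CommRing R] [AddCommGroup M]
    [Module R M] (I : Ideal R) [IsArtinianRing (R ⧸ I)] (h : ∀ r ∈ I, ∀ x : M, r • x = 0) :
    (IsNoetherian R M ↔ IsArtinian R M) := by
  have ht : Module.IsTorsionBySet R M I := fun x r => h r r.2 x
  let _ := ht.module
  have : IsScalarTower R (R ⧸ I) M := ht.isScalarTower
  rw [ht.semilinearMap.isNoetherian_iff_of_bijective Function.bijective_id,
    ht.semilinearMap.isArtinian_iff_of_bijective Function.bijective_id]
  exact IsSemiprimaryRing.isNoetherian_iff_isArtinian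

/-- A mini-max module annihilated by an ideal with artinian quotient has finite length. -/
theorem IsMiniMax.isFiniteLength {R M : Type*} [CommRing R] [AddCommGroup M] [Module R M]
    (hM : IsMiniMax R M) (I : Ideal R) [IsArtinianRing (R ⧸ I)]
    (h : ∀ r ∈ I, ∀ x : M, r • x = 0) : IsFiniteLength R M := by
  obtain ⟨N, hN, hQ⟩ := hM
  have h1 : IsArtinian R N :=
    (isNoetherian_iff_isArtinian_of_annihilated I fun r hr x => Subtype.ext (h r hr x)).1 hN
  have : IsArtinian R M := isArtinian_of_range_eq_ker N.subtype N.mkQ (by simp)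
  have := (isNoetherian_iff_isArtinian_of_annihilated I h).2 this
  exact isFiniteLength_iff_isNoetherian_isArtinian.2 ⟨this, ‹_›⟩

end MiniMax

/-! ### Artinian modules and powers of an element -/

/-- If every element of `T` is killed by a power of `x` and the kernel of `x` on `T` is artinian,
then `T` is artinian. -/
theorem isArtinian_of_isArtinian_ker_smul {R T : Type*} [CommRing R] [AddCommGroup T] [Module R T]
    (x : R) (hT : ∀ t : T, ∃ n : ℕ, x ^ n • t = 0)
    [IsArtinian R (LinearMap.ker (LinearMap.lsmul R T x))] : IsArtinian R T := by
  -- `V U n` is `x ^ n U ∩ ker x`: increasing in `U`, decreasing in `n`, and living in the artinian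
  -- module `ker x`.
  let V : Submodule R T → ℕ → Submodule R (LinearMap.ker (LinearMap.lsmul R T x)) := fun U n =>
    (U.map (LinearMap.lsmul R T (x ^ n))).comap (Submodule.subtype _)
  have hV : ∀ {U U' n n'}, U ≤ U' → n ≤ n' → V U n' ≤ V U' n := by
    rintro U U' n n' hU hn ⟨_, hy⟩ ⟨u, hu, rfl⟩
    refine ⟨x ^ (n' - n) • u, U'.smul_mem _ (hU hu), ?_⟩
    simp only [LinearMap.lsmul_apply, Submodule.subtype_apply, smul_smul, ← pow_add]
    congr 2; omega
  rw [← monotone_stabilizes_iff_artinian]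
  intro f'
  let f : ℕ → Submodule R T := fun n => OrderDual.ofDual (f' n)
  have hf : ∀ {i j}, i ≤ j → f j ≤ f i := fun h => f'.monotone h
  obtain ⟨N, hN⟩ := IsArtinian.monotone_stabilizes
    (⟨fun n => OrderDual.toDual (V (f n) n), fun i j h => hV (hf h) h⟩ :
      ℕ →o (Submodule R (LinearMap.ker (LinearMap.lsmul R T x)))ᵒᵈ)
  have hN' : ∀ n, ∃ J, ∀ j, J ≤ j → V (f J) n = V (f j) n := fun n =>
    IsArtinian.monotone_stabilizes
      (⟨fun j => OrderDual.toDual (V (f j) n), fun i j h => hV (hf h) le_rfl⟩ :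
        ℕ →o (Submodule R (LinearMap.ker (LinearMap.lsmul R T x)))ᵒᵈ)
  choose J hJ using hN'
  -- `N` settles all `n ≥ N` at once, through the diagonal `V (f n) n`; the finitely many smaller
  -- `n` each need their own bound `J n`.
  let K := max N ((Finset.range N).sup J)
  have hK : ∀ j, K ≤ j → ∀ n, V (f K) n = V (f j) n := by
    intro j hj n
    rcases lt_or_ge n N with hn | hn
    · have hJK : J n ≤ K := (Finset.le_sup (f := J) (Finset.mem_range.2 hn)).trans (le_max_right _ _)
      rw [← hJ n K hJK, ← hJ n j (hJK.trans hj)]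
    · have key : ∀ i, N ≤ i → V (f i) n = V (f N) N := fun i hi => by
        refine le_antisymm (hV (hf hi) hn) ?_
        have := hN (max i n) (le_max_of_le_left hi)
        change V (f N) N = V (f (max i n)) (max i n) at this
        rw [this]
        exact hV (hf (le_max_left i n)) (le_max_right i n)
      rw [key K (le_max_left _ _), key j ((le_max_left _ _).trans hj)]
  refine ⟨K, fun j hj => le_antisymm (α := Submodule R T) ?_ (hf hj)⟩
  -- The `V (f j) n` determine `f j` inside `f K`: subtracting some `u' ∈ f j` with `x ^ n u' = x ^
  -- n u` leaves an element killed by a lower power of `x`.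
  have main : ∀ n, ∀ u ∈ f K, x ^ n • u = 0 → u ∈ f j := by
    intro n
    induction n with
    | zero => intro u _ h; simp at h; simp [h]
    | succ n ih =>
      intro u hu h
      have h1 : (⟨x ^ n • u, by
          rw [LinearMap.mem_ker, LinearMap.lsmul_apply, smul_smul, ← pow_succ', h]⟩ :
          LinearMap.ker (LinearMap.lsmul R T x)) ∈ V (f K) n := ⟨u, hu, rfl⟩
      rw [hK j hj n] at h1
      obtain ⟨u', hu', h2⟩ := h1
      have h3 : x ^ n • u' = x ^ n • u := h2
      have := ih (u - u') (sub_mem hu (hf hj hu')) (by rw [smul_sub, h3, sub_self])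
      simpa using add_mem this hu'
  intro u hu
  obtain ⟨n, hn⟩ := hT u
  exact main n u hu hn

/-- Every element of an artinian module is killed by a power of each element of the maximal
ideal. -/
theorem IsArtinian.exists_pow_smul_eq_zero {R A : Type*} [CommRing R] [IsLocalRing R]
    [AddCommGroup A] [Module R A] [IsArtinian R A] {x : R} (hx : x ∈ maximalIdeal R) (a : A) :
    ∃ n : ℕ, x ^ n • a = 0 := by
  obtain ⟨n, hn⟩ := IsArtinian.monotone_stabilizes
    (⟨fun n => OrderDual.toDual (Submodule.span R {x ^ n • a}), fun i j h => by
      change Submodule.span R _ ≤ Submodule.span R _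
      rw [Submodule.span_singleton_le_iff_mem, Submodule.mem_span_singleton]
      exact ⟨x ^ (j - i), by rw [smul_smul, ← pow_add]; congr 2; omega⟩⟩ :
      ℕ →o (Submodule R A)ᵒᵈ)
  have h : Submodule.span R {x ^ n • a} = Submodule.span R {x ^ (n + 1) • a} :=
    hn (n + 1) (Nat.le_succ n)
  have h1 : x ^ n • a ∈ Submodule.span R {x ^ (n + 1) • a} := by
    rw [← h]; exact Submodule.mem_span_singleton_self _
  obtain ⟨s, hs⟩ := Submodule.mem_span_singleton.1 h1
  refine ⟨n, ?_⟩
  -- From `x ^ n a = s x ^ (n + 1) a`, the unit `1 - s x` kills `x ^ n a`.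
  have hu : IsUnit (1 - s * x) := by
    by_contra hne
    have : (1 - s * x) + s * x ∈ maximalIdeal R :=
      add_mem ((mem_maximalIdeal _).2 hne) (Ideal.mul_mem_left _ _ hx)
    simp at this
  rw [← hu.smul_eq_zero, sub_smul, one_smul, mul_smul, smul_smul x, ← pow_succ', hs, sub_self]

/-! ### Matlis reflexivity modulo an ideal with precomplete noetherian quotient -/

section Matlis

variable (S : Type u) [CommRing S] [IsLocalRing S]

/-- A linear map to the Matlis module extends along any linear map through which it factors on the
level of kernels. -/
theorem matlisModule_exists_extension {B C : Type u} [AddCommGroup B] [Module S B]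
    [AddCommGroup C] [Module S C] (g : B →ₗ[S] C) (ψ : B →ₗ[S] matlisModule S)
    (h : LinearMap.ker g ≤ LinearMap.ker ψ) : ∃ χ : C →ₗ[S] matlisModule S, χ ∘ₗ g = ψ := by
  have hinj : Function.Injective ((LinearMap.ker g).liftQ g le_rfl) :=
    LinearMap.ker_eq_bot.1 (Submodule.ker_liftQ_eq_bot _ _ _ le_rfl)
  obtain ⟨χ, hχ⟩ := (isInjectiveHull_matlisModuleEmbedding S).module_injective.out _ hinj
    ((LinearMap.ker g).liftQ ψ h)
  refine ⟨χ, LinearMap.ext fun b => ?_⟩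
  simpa using hχ (Submodule.Quotient.mk b)

/-- The Matlis module is a cogenerator. -/
theorem matlisModule_exists_ne_zero {L : Type u} [AddCommGroup L] [Module S L] {x : L}
    (hx : x ≠ 0) : ∃ χ : L →ₗ[S] matlisModule S, χ x ≠ 0 := by
  -- Since `x ≠ 0`, its annihilator lies in the maximal ideal, so `x ↦ 1` defines a map from the
  -- span of `x` to the residue field; injectivity extends it to `L`.
  obtain ⟨χ, hχ⟩ := matlisModule_exists_extension S (LinearMap.toSpanSingleton S L x)
    (LinearMap.toSpanSingleton S _ (matlisModuleEmbedding S 1)) (by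
      intro r hr
      have hr' : r • x = 0 := by simpa using hr
      have hrm : r ∈ maximalIdeal S := by
        rw [mem_maximalIdeal, mem_nonunits_iff]
        exact fun hu => hx (hu.smul_eq_zero.1 hr')
      rw [LinearMap.mem_ker, LinearMap.toSpanSingleton_apply, ← map_smul, Algebra.smul_def,
        ResidueField.algebraMap_eq, (residue_eq_zero_iff r).2 hrm, zero_mul, map_zero])
  refine ⟨χ, fun h0 => ?_⟩
  have := LinearMap.congr_fun hχ 1
  simp only [LinearMap.comp_apply, LinearMap.toSpanSingleton_apply, one_smul, h0] at this
  have h1 := (isInjectiveHull_matlisModuleEmbedding S).map_injective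
    (this.symm.trans (map_zero _).symm)
  exact one_ne_zero h1

theorem matlisBiduality_injective (L : Type u) [AddCommGroup L] [Module S L] :
    Function.Injective (matlisBiduality S L) := by
  rw [injective_iff_map_eq_zero]
  intro x hx
  by_contra hne
  obtain ⟨χ, hχ⟩ := matlisModule_exists_ne_zero S hne
  exact hχ (LinearMap.congr_fun hx χ)

theorem isMatlisReflexive_iff (L : Type u) [AddCommGroup L] [Module S L] :
    IsMatlisReflexive S L ↔ ∀ φ : MatlisDual S (MatlisDual S L), ∃ x : L, ∀ ψ, φ ψ = ψ x := by
  refine ⟨fun h φ => ?_, fun h => ⟨matlisBiduality_injective S L, fun φ => ?_⟩⟩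
  · obtain ⟨x, rfl⟩ := h.2 φ
    exact ⟨x, fun _ => rfl⟩
  · obtain ⟨x, hx⟩ := h φ
    exact ⟨x, LinearMap.ext fun ψ => (hx ψ).symm⟩

/-- A functional on the dual of `B` is corrected in two stages: its image in the bidual of `C` is
evaluation at some `g b`, and after subtracting evaluation at `b` the rest comes from the bidual of
`A`. -/
theorem isSerreClass_isMatlisReflexive :
    IsSerreClass S fun L _ _ => IsMatlisReflexive S L where
  of_subsingleton L _ _ _ := (isMatlisReflexive_iff S L).2 fun φ =>
    ⟨0, fun ψ => by rw [Subsingleton.elim ψ 0, map_zero, LinearMap.zero_apply]⟩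
  of_exact {A B C} _ _ _ _ _ _ f g hfg hA hC := by
    rw [isMatlisReflexive_iff] at *
    intro φ
    obtain ⟨c, hc⟩ := hC (φ ∘ₗ LinearMap.lcomp S _ g)
    -- Otherwise some map `C → E` vanishes on the range of `g` but not at `c`, contradicting `hc`.
    have hcg : c ∈ LinearMap.range g := by
      by_contra hcg
      have hne : (LinearMap.range g).mkQ c ≠ 0 := by simpa using hcg
      obtain ⟨χ, hχ⟩ := matlisModule_exists_ne_zero S hne
      apply hχ
      have := hc (χ ∘ₗ (LinearMap.range g).mkQ)
      rw [LinearMap.comp_apply, LinearMap.comp_apply] at this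
      rw [← this]
      convert map_zero φ
      ext b
      have h0 : (LinearMap.range g).mkQ (g b) = 0 :=
        (Submodule.Quotient.mk_eq_zero _).2 ⟨b, rfl⟩
      exact (congrArg χ h0).trans (map_zero χ)
    obtain ⟨b, rfl⟩ := hcg
    let φ' := φ - matlisBiduality S B b
    have hφ' : ∀ ψ : MatlisDual S B, ψ ∘ₗ f = 0 → φ' ψ = 0 := by
      intro ψ hψ
      obtain ⟨χ, rfl⟩ := matlisModule_exists_extension S g ψ (by
        intro y hy
        obtain ⟨a, rfl⟩ := (hfg y).1 hy
        exact LinearMap.congr_fun hψ a)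
      exact sub_eq_zero.2 (hc χ)
    -- `φ'` depends only on `ψ ∘ f`; injectivity of `E` extends it from such restrictions to the
    -- whole dual of `A`.
    obtain ⟨α, hα⟩ := matlisModule_exists_extension S (LinearMap.lcomp S (matlisModule S) f) φ'
      (fun ψ hψ => hφ' ψ hψ)
    obtain ⟨a, ha⟩ := hA α
    refine ⟨f a + b, fun ψ => ?_⟩
    have h1 := LinearMap.congr_fun hα ψ
    have h2 := ha (ψ ∘ₗ f)
    have h3 : φ ψ - ψ b = ψ (f a) := h1.symm.trans h2
    rw [map_add, ← h3, sub_add_cancel]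

variable {S}

theorem residueField_smul_eq_zero {r : S} (hr : r ∈ maximalIdeal S) (c : ResidueField S) :
    r • c = 0 := by
  rw [Algebra.smul_def, ResidueField.algebraMap_eq, (residue_eq_zero_iff r).2 hr, zero_mul]

/-- The socle of the Matlis module is the residue field. -/
theorem matlisModule_mem_range_embedding {e : matlisModule S}
    (he : ∀ r ∈ maximalIdeal S, r • e = 0) : ∃ c, matlisModuleEmbedding S c = e := by
  by_cases h0 : e = 0
  · exact ⟨0, by simp [h0]⟩
  have hne : Submodule.span S {e} ⊓ LinearMap.range (matlisModuleEmbedding S) ≠ ⊥ := fun h =>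
    h0 (Submodule.span_singleton_eq_bot.1
      ((isInjectiveHull_matlisModuleEmbedding S).essential _ h))
  obtain ⟨y, ⟨hy, c, hc⟩, hy0⟩ := Submodule.exists_mem_ne_zero_of_ne_bot hne
  obtain ⟨r, rfl⟩ := Submodule.mem_span_singleton.1 hy
  have hu : IsUnit r := by
    by_contra hr
    exact hy0 (he r ((mem_maximalIdeal _).2 hr))
  obtain ⟨u, rfl⟩ := hu
  refine ⟨(↑u⁻¹ : S) • c, ?_⟩
  rw [map_smul, hc, smul_smul, Units.inv_mul, one_smul]

/-- Every map from the residue field to `E` lands in the socle, which is the residue field again, so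
the dual is spanned by the embedding. A functional is therefore determined by its value there,
itself a socle element. -/
theorem isMatlisReflexive_residueField : IsMatlisReflexive S (ResidueField S) := by
  rw [isMatlisReflexive_iff]
  intro φ
  have hker : ∀ r ∈ maximalIdeal S, ∀ ψ : MatlisDual S (ResidueField S), r • ψ = 0 :=
    fun r hr ψ => LinearMap.ext fun c => by
      rw [LinearMap.smul_apply, ← map_smul, residueField_smul_eq_zero hr, map_zero,
        LinearMap.zero_apply]
  obtain ⟨c, hc⟩ := matlisModule_mem_range_embedding (e := φ (matlisModuleEmbedding S))
    fun r hr => by rw [← map_smul, hker r hr, map_zero]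
  refine ⟨c, fun ψ => ?_⟩
  obtain ⟨d, hd⟩ := matlisModule_mem_range_embedding (e := ψ 1)
    fun r hr => by rw [← LinearMap.smul_apply, hker r hr, LinearMap.zero_apply]
  obtain ⟨s, rfl⟩ := residue_surjective d
  have hψ : ψ = s • matlisModuleEmbedding S := by
    ext x
    obtain ⟨t, rfl⟩ := residue_surjective x
    have hres : ∀ y : S, residue S y = y • (1 : ResidueField S) := fun y => by
      rw [Algebra.smul_def, mul_one]; rfl
    rw [LinearMap.smul_apply, hres t, map_smul, map_smul, ← hd, hres s, map_smul, smul_comm]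
  rw [hψ, map_smul, LinearMap.smul_apply, hc]

/-- A noetherian module killed by a power of the maximal ideal is Matlis reflexive. -/
theorem isMatlisReflexive_of_isNoetherian_of_pow (n : ℕ) (L : Type u) [AddCommGroup L]
    [Module S L] [IsNoetherian S L] (h : ∀ r ∈ maximalIdeal S ^ n, ∀ x : L, r • x = 0) :
    IsMatlisReflexive S L := by
  induction n generalizing L with
  | zero =>
    have : Subsingleton L := ⟨fun x y => by
      rw [← one_smul S x, ← one_smul S y, h 1 (by simp), h 1 (by simp)]⟩
    exact (isSerreClass_isMatlisReflexive S).of_subsingleton L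
  | succ n ih =>
    let N : Submodule S L := maximalIdeal S • ⊤
    refine (isSerreClass_isMatlisReflexive S).of_submodule_quotient N (ih N ?_) ?_
    · rintro r hr ⟨x, hx⟩
      apply Subtype.ext
      change r • x = 0
      induction hx using Submodule.smul_induction_on' with
      | smul s hs y _ => rw [smul_smul, h _ (pow_succ (maximalIdeal S) n ▸ Ideal.mul_mem_mul hr hs)]
      | add x _ y _ h1 h2 => rw [smul_add, h1, h2, add_zero]
    · refine (isSerreClass_isMatlisReflexive S).of_finite_of_annihilated (maximalIdeal S)
        (isMatlisReflexive_residueField (S := S)) ?_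
      intro r hr a
      obtain ⟨a, rfl⟩ := Submodule.Quotient.mk_surjective _ a
      rw [← Submodule.Quotient.mk_smul, Submodule.Quotient.mk_eq_zero]
      exact Submodule.smul_mem_smul hr trivial

theorem IsMatlisReflexive.dual {L : Type u} [AddCommGroup L] [Module S L]
    (h : IsMatlisReflexive S L) : IsMatlisReflexive S (MatlisDual S L) := by
  rw [isMatlisReflexive_iff]
  intro Φ
  refine ⟨Φ ∘ₗ matlisBiduality S L, fun φ => ?_⟩
  obtain ⟨x, rfl⟩ := h.2 φ
  rfl

/-- Elements of the Matlis module that generate a noetherian submodule are killed by powers of the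
elements of the maximal ideal. -/
theorem matlisModule_exists_pow_smul_eq_zero (e : matlisModule S)
    [IsNoetherian S (Submodule.span S {e})] {x : S} (hx : x ∈ maximalIdeal S) :
    ∃ n : ℕ, x ^ n • e = 0 := by
  obtain ⟨n, hn⟩ := monotone_stabilizes_iff_noetherian.2
    (inferInstanceAs (IsNoetherian S (Submodule.span S {e})))
    (⟨fun n => LinearMap.ker (LinearMap.lsmul S (Submodule.span S {e}) (x ^ n)),
      monotone_nat_of_le_succ fun n y hy => by
        rw [LinearMap.mem_ker, LinearMap.lsmul_apply] at hy ⊢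
        rw [pow_succ', mul_smul, hy, smul_zero]⟩)
  refine ⟨n, ?_⟩
  -- By essentiality it suffices to meet the residue field trivially. If `r x ^ n e` lies there,
  -- then `x` kills it, and stability of the kernels gives `x ^ n r e = 0`.
  have : Submodule.span S {x ^ n • e} = ⊥ := by
    apply (isInjectiveHull_matlisModuleEmbedding S).essential
    rw [eq_bot_iff]
    rintro y ⟨hy, c, rfl⟩
    obtain ⟨r, hr⟩ := Submodule.mem_span_singleton.1 hy
    let z : Submodule.span S {e} :=
      ⟨r • e, Submodule.smul_mem _ _ (Submodule.mem_span_singleton_self e)⟩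
    have hz : z ∈ LinearMap.ker (LinearMap.lsmul S (Submodule.span S {e}) (x ^ (n + 1))) := by
      apply Subtype.ext
      change x ^ (n + 1) • r • e = 0
      rw [pow_succ', mul_smul, smul_comm (x ^ n) r e, hr, ← map_smul,
        residueField_smul_eq_zero hx, map_zero]
    have hz' : z ∈ LinearMap.ker (LinearMap.lsmul S (Submodule.span S {e}) (x ^ n)) := by
      have := hn (n + 1) (Nat.le_succ n)
      exact (SetLike.ext_iff.1 this z).2 hz
    have h0 : x ^ n • r • e = 0 := congrArg Subtype.val hz'
    rw [smul_comm, hr] at h0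
    exact h0
  exact Submodule.span_singleton_eq_bot.1 this

/-- Sequences that are Cauchy for the `I`-adic topology on the quotient by `b` converge. -/
def IsPrecompleteModulo {S : Type*} [CommRing S] (I b : Ideal S) : Prop :=
  ∀ f : ℕ → S, (∀ n, f (n + 1) - f n ∈ b ⊔ I ^ n) → ∃ r, ∀ n, r - f n ∈ b ⊔ I ^ n

/-- Each element of the maximal ideal has a power in the annihilator of `e`. Finite generation of
the maximal ideal modulo `b` makes the exponent uniform; `S` itself need not be noetherian. -/
theorem matlisModule_exists_maximalIdeal_pow_smul_eq_zero (b : Ideal S) [IsNoetherian S (S ⧸ b)]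
    (e : matlisModule S) (he : ∀ r ∈ b, r • e = 0) :
    ∃ n : ℕ, ∀ r ∈ b ⊔ maximalIdeal S ^ n, r • e = 0 := by
  have hspan : IsNoetherian S (Submodule.span S {e}) := by
    rw [← LinearMap.range_toSpanSingleton]
    have hle : b ≤ LinearMap.ker (LinearMap.toSpanSingleton S _ e) := fun r hr =>
      he r hr
    rw [← Submodule.range_liftQ b _ hle]
    infer_instance
  have : IsNoetherianRing (S ⧸ b) := isNoetherian_of_tower S ‹_›
  let J : Ideal S := LinearMap.ker (LinearMap.toSpanSingleton S _ e)
  have hJ : ∀ r, r ∈ J ↔ r • e = 0 := fun r => Iff.rfl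
  have hbJ : b ≤ J := fun r hr => (hJ r).2 (he r hr)
  have hrad : (maximalIdeal S).map (Ideal.Quotient.mk b) ≤
      (J.map (Ideal.Quotient.mk b)).radical := by
    rw [Ideal.map_le_iff_le_comap]
    intro x hx
    obtain ⟨n, hn⟩ := matlisModule_exists_pow_smul_eq_zero e hx
    exact ⟨n, by rw [← map_pow]; exact Ideal.mem_map_of_mem _ ((hJ _).2 hn)⟩
  obtain ⟨n, hn⟩ := Ideal.exists_pow_le_of_le_radical_of_fg hrad
    (IsNoetherian.noetherian _)
  refine ⟨n, fun r hr => (hJ r).1 (sup_le hbJ ?_ hr)⟩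
  rw [← Ideal.map_pow, Ideal.map_le_iff_le_comap,
    Ideal.comap_map_of_surjective _ Ideal.Quotient.mk_surjective, ← RingHom.ker_eq_comap_bot,
    Ideal.mk_ker, sup_eq_left.2 hbJ] at hn
  exact hn

/-- On each `S ⧸ (b + m ^ n)`, which is reflexive, `φ` is evaluation at some `f n`. These are
compatible and converge to some `r`. Every map `S ⧸ b → E` factors through one of these quotients,
so `φ` is evaluation at `r`. -/
theorem isMatlisReflexive_quotient (b : Ideal S) [IsNoetherian S (S ⧸ b)]
    (hb : IsPrecompleteModulo (maximalIdeal S) b) : IsMatlisReflexive S (S ⧸ b) := by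
  rw [isMatlisReflexive_iff]
  intro φ
  let c : ℕ → Ideal S := fun n => b ⊔ maximalIdeal S ^ n
  have hbc : ∀ n, b ≤ c n := fun n => le_sup_left
  have hnoeth : ∀ n, IsNoetherian S (S ⧸ c n) := fun n =>
    isNoetherian_of_surjective (Submodule.factor (hbc n))
      (LinearMap.range_eq_top.2 (Submodule.factor_surjective (hbc n)))
  have hrefl : ∀ n, IsMatlisReflexive S (S ⧸ c n) := fun n => by
    refine isMatlisReflexive_of_isNoetherian_of_pow n _ fun r hr x => ?_
    obtain ⟨x, rfl⟩ := Submodule.Quotient.mk_surjective _ x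
    rw [← Submodule.Quotient.mk_smul, Submodule.Quotient.mk_eq_zero]
    exact Ideal.mul_mem_right x _ (Ideal.mem_sup_right hr)
  have hex : ∀ n, ∃ r : S, ∀ ψ : MatlisDual S (S ⧸ c n),
      φ (ψ ∘ₗ Submodule.factor (hbc n)) = ψ (Submodule.Quotient.mk r) := fun n => by
    obtain ⟨x, hx⟩ := (isMatlisReflexive_iff S _).1 (hrefl n)
      (φ ∘ₗ LinearMap.lcomp S _ (Submodule.factor (hbc n)))
    obtain ⟨r, rfl⟩ := Submodule.Quotient.mk_surjective _ x
    exact ⟨r, hx⟩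
  choose f hf using hex
  obtain ⟨r, hr⟩ := hb f fun n => by
    have hcc : c (n + 1) ≤ c n := sup_le_sup_left (Ideal.pow_le_pow_right (Nat.le_succ n)) b
    rw [← Submodule.Quotient.eq]
    refine matlisBiduality_injective S _ (LinearMap.ext fun ψ => ?_)
    change ψ (Submodule.Quotient.mk (f (n + 1))) = ψ (Submodule.Quotient.mk (f n))
    rw [← hf n ψ]
    refine (hf (n + 1) (ψ ∘ₗ Submodule.factor hcc)).symm.trans ?_
    congr 1
    ext
    rfl
  refine ⟨Submodule.Quotient.mk r, fun ψ => ?_⟩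
  obtain ⟨n, hn⟩ := matlisModule_exists_maximalIdeal_pow_smul_eq_zero b
    (ψ (Submodule.Quotient.mk 1)) fun s hs => by
      rw [← map_smul, ← Submodule.Quotient.mk_smul, smul_eq_mul, mul_one,
        (Submodule.Quotient.mk_eq_zero b).2 hs, map_zero]
  let χ : MatlisDual S (S ⧸ c n) :=
    Submodule.liftQ (c n) (LinearMap.toSpanSingleton S _ (ψ (Submodule.Quotient.mk 1)))
      fun s hs => hn s hs
  have hψ : ψ = χ ∘ₗ Submodule.factor (hbc n) := by
    ext
    exact (one_smul S (ψ (Submodule.Quotient.mk 1))).symm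
  have h1 := hf n χ
  rw [← hψ] at h1
  rw [h1, ← (Submodule.Quotient.eq (c n)).2 (hr n), hψ]
  rfl

/-- By the descending chain condition, finitely many maps `A → E` have the smallest possible common
kernel, which is zero as `E` cogenerates. Each such map lands in the `b`-torsion of `E`, that is, in
the dual of `S ⧸ b`, so `A` embeds in a finite power of a reflexive module. -/
theorem isMatlisReflexive_of_isArtinian (b : Ideal S) [IsNoetherian S (S ⧸ b)]
    (hb : IsPrecompleteModulo (maximalIdeal S) b) {A : Type u} [AddCommGroup A] [Module S A]
    [IsArtinian S A] (h : ∀ r ∈ b, ∀ a : A, r • a = 0) : IsMatlisReflexive S A := by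
  obtain ⟨t, ht⟩ := Finset.exists_inf_le
    (fun ψ : A →ₗ[S] matlisModule S => LinearMap.ker ψ)
  let F : (A →ₗ[S] matlisModule S) → A →ₗ[S] MatlisDual S (S ⧸ b) := fun ψ =>
    { toFun := fun a => Submodule.liftQ b (LinearMap.toSpanSingleton S _ (ψ a)) fun r hr => by
        rw [LinearMap.mem_ker, LinearMap.toSpanSingleton_apply, ← map_smul, h r hr, map_zero]
      map_add' := fun x y => by
        ext
        change (1 : S) • ψ (x + y) = (1 : S) • ψ x + (1 : S) • ψ y
        rw [map_add, smul_add]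
      map_smul' := fun r x => by
        ext
        change (1 : S) • ψ (r • x) = r • (1 : S) • ψ x
        rw [map_smul, smul_comm] }
  refine (isSerreClass_isMatlisReflexive S).pi (isMatlisReflexive_quotient b hb).dual t
    (LinearMap.pi fun ψ => F ψ) ?_
  rw [injective_iff_map_eq_zero]
  intro a ha
  by_contra hne
  obtain ⟨χ, hχ⟩ := matlisModule_exists_ne_zero S hne
  refine hχ (ht χ ?_)
  rw [Submodule.mem_finsetInf]
  intro ψ hψ
  have h1 := LinearMap.congr_fun (congrFun ha ⟨ψ, hψ⟩) (Submodule.Quotient.mk 1)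
  exact (one_smul S (ψ a)).symm.trans h1

/-- Mini-max modules annihilated by an ideal with complete noetherian quotient are Matlis
reflexive. -/
theorem IsMiniMax.isMatlisReflexive (b : Ideal S) [IsNoetherian S (S ⧸ b)]
    (hb : IsPrecompleteModulo (maximalIdeal S) b) {L : Type u} [AddCommGroup L] [Module S L]
    (hL : IsMiniMax S L) (h : ∀ r ∈ b, ∀ a : L, r • a = 0) : IsMatlisReflexive S L := by
  obtain ⟨N, hN, hQ⟩ := hL
  refine (isSerreClass_isMatlisReflexive S).of_submodule_quotient N ?_ ?_
  · exact (isSerreClass_isMatlisReflexive S).of_finite_of_annihilated b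
      (isMatlisReflexive_quotient b hb) fun r hr a => Subtype.ext (h r hr a)
  · refine isMatlisReflexive_of_isArtinian b hb fun r hr a => ?_
    obtain ⟨a, rfl⟩ := Submodule.Quotient.mk_surjective _ a
    rw [← Submodule.Quotient.mk_smul, h r hr, Submodule.Quotient.mk_zero]

end Matlis

/-! ### Passage to the completion -/

section Completion

theorem IsCompleteQuotient.isPrecompleteModulo {R : Type u} [CommRing R] [IsLocalRing R]
    {a : Ideal R} (h : IsCompleteQuotient R a) : IsPrecompleteModulo (maximalIdeal R) a := by
  intro f hf
  have key : ∀ n (x : R), Ideal.Quotient.mk a x ∈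
      ((maximalIdeal R).map (Ideal.Quotient.mk a) ^ n • ⊤ : Submodule (R ⧸ a) (R ⧸ a)) ↔
      x ∈ a ⊔ maximalIdeal R ^ n := fun n x => by
    rw [smul_eq_mul, Ideal.mul_top, ← Ideal.map_pow, Ideal.mem_quotient_iff_mem_sup, sup_comm]
  obtain ⟨L, hL⟩ := h.toIsPrecomplete.prec (f := fun n => Ideal.Quotient.mk a (f n)) (by
    intro m n hmn
    rw [SModEq.comm, SModEq.sub_mem, ← map_sub, key]
    induction n, hmn using Nat.le_induction with
    | base => simp
    | succ n hmn ih =>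
      have : f (n + 1) - f m = (f (n + 1) - f n) + (f n - f m) := by ring
      rw [this]
      exact add_mem (sup_le_sup_left (Ideal.pow_le_pow_right hmn) a (hf n)) ih)
  obtain ⟨r, rfl⟩ := Ideal.Quotient.mk_surjective L
  refine ⟨r, fun n => ?_⟩
  have := (hL n).symm
  rwa [SModEq.sub_mem, ← map_sub, key] at this

theorem Ideal.mkQ_mem_pow_smul_top {R : Type*} [CommRing R] (I a : Ideal R) (n : ℕ) {x : R}
    (hx : x ∈ a ⊔ I ^ n) : (a.mkQ x) ∈ (I ^ n • ⊤ : Submodule R (R ⧸ a)) := by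
  obtain ⟨y, hy, z, hz, rfl⟩ := Submodule.mem_sup.1 hx
  have h1 : a.mkQ y = 0 := (Submodule.Quotient.mk_eq_zero a).2 hy
  have h2 : a.mkQ z = z • a.mkQ 1 := by rw [← map_smul, smul_eq_mul, mul_one]
  rw [map_add, h1, zero_add, h2]
  exact Submodule.smul_mem_smul hz trivial

variable {R : Type u} [CommRing R] [IsLocalRing R] {T : Type u} [AddCommGroup T] [Module R T]

theorem LocalCompletion.smul_eq_zero_of_mem_map {a : Ideal R} (hT : ∀ r ∈ a, ∀ t : T, r • t = 0)
    [Module (LocalCompletion R) T] [IsScalarTower R (LocalCompletion R) T]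
    {s : LocalCompletion R} (hs : s ∈ a.map (algebraMap R (LocalCompletion R))) (t : T) :
    s • t = 0 := by
  have hle : a.map (algebraMap R (LocalCompletion R)) ≤
      Module.annihilator (LocalCompletion R) T := by
    rw [Ideal.map_le_iff_le_comap]
    intro r hr
    rw [Ideal.mem_comap, Module.mem_annihilator]
    intro t
    rw [algebraMap_smul]
    exact hT r hr t
  exact Module.mem_annihilator.1 (hle hs) t

theorem LocalCompletion.smul_eq_of_sub_mem_map {a : Ideal R}
    (hT : ∀ r ∈ a, ∀ t : T, r • t = 0)
    [Module (LocalCompletion R) T] [IsScalarTower R (LocalCompletion R) T]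
    {s : LocalCompletion R} {r : R}
    (hs : s - algebraMap R (LocalCompletion R) r ∈ a.map (algebraMap R (LocalCompletion R)))
    (t : T) : s • t = r • t := by
  have := LocalCompletion.smul_eq_zero_of_mem_map hT hs t
  rwa [sub_smul, algebraMap_smul, sub_eq_zero] at this

/-- The projection of the completion to `R ⧸ m ^ n`, followed by reduction to `R ⧸ (a + m ^ n)`,
extends the quotient map of `R` and kills the extended ideal. -/
theorem LocalCompletion.mem_of_algebraMap_mem_map (a : Ideal R) (n : ℕ) {x : R}
    (hx : algebraMap R (LocalCompletion R) x ∈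
      (a ⊔ maximalIdeal R ^ n).map (algebraMap R (LocalCompletion R))) :
    x ∈ a ⊔ maximalIdeal R ^ n := by
  let φ : LocalCompletion R →+* R ⧸ (a ⊔ maximalIdeal R ^ n) :=
    (Ideal.Quotient.factor (le_sup_right : maximalIdeal R ^ n ≤ a ⊔ maximalIdeal R ^ n)).comp
      (AdicCompletion.evalₐ (maximalIdeal R) n).toRingHom
  have hφ : ∀ y, φ (algebraMap R _ y) = Ideal.Quotient.mk _ y := fun y => by
    have : AdicCompletion.evalₐ (maximalIdeal R) n (algebraMap R (LocalCompletion R) y) =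
      Ideal.Quotient.mk _ y := AlgHom.commutes _ y
    exact congrArg (Ideal.Quotient.factor
      (le_sup_right : maximalIdeal R ^ n ≤ a ⊔ maximalIdeal R ^ n)) this
  have hle : (a ⊔ maximalIdeal R ^ n).map (algebraMap R (LocalCompletion R)) ≤ RingHom.ker φ := by
    rw [Ideal.map_le_iff_le_comap]
    intro y hy
    rw [Ideal.mem_comap, RingHom.mem_ker, hφ]
    exact Ideal.Quotient.eq_zero_iff_mem.2 hy
  have := hle hx
  rw [RingHom.mem_ker, hφ] at this
  exact Ideal.Quotient.eq_zero_iff_mem.1 this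

variable [IsNoetherianRing R]

/-- An element of the contraction lies in every `a + m ^ n`, hence in `a`, as `R ⧸ a` is Hausdorff.
-/
theorem LocalCompletion.comap_map_eq (a : Ideal R) :
    (a.map (algebraMap R (LocalCompletion R))).comap (algebraMap R (LocalCompletion R)) = a := by
  refine le_antisymm (fun x hx => ?_) Ideal.le_comap_map
  have hH : IsHausdorff (maximalIdeal R) (R ⧸ a) := inferInstance
  refine (Submodule.Quotient.mk_eq_zero a).1 (hH.haus _ fun n => ?_)
  rw [SModEq.zero]
  exact Ideal.mkQ_mem_pow_smul_top _ a n
    (LocalCompletion.mem_of_algebraMap_mem_map a n (Ideal.map_mono le_sup_left hx))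

theorem LocalCompletion.map_sup_pow (a : Ideal R) (n : ℕ) :
    (a ⊔ maximalIdeal R ^ n).map (algebraMap R (LocalCompletion R)) =
      a.map (algebraMap R (LocalCompletion R)) ⊔ maximalIdeal (LocalCompletion R) ^ n := by
  rw [Ideal.map_sup, Ideal.map_pow, AdicCompletion.maximalIdeal_eq_map]

/-- If `R ⧸ a` is complete, then `R` surjects onto the quotient of the completion by the extension
of `a`. -/
theorem LocalCompletion.exists_sub_mem_map {a : Ideal R}
    (h : IsPrecompleteModulo (maximalIdeal R) a) (s : LocalCompletion R) :
    ∃ r : R, s - algebraMap R (LocalCompletion R) r ∈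
      a.map (algebraMap R (LocalCompletion R)) := by
  obtain ⟨x, rfl⟩ := AdicCompletion.mk_surjective (maximalIdeal R) R s
  obtain ⟨r, hr⟩ := h x fun n => by
    have := (x.2 (Nat.le_succ n)).symm
    rw [SModEq.sub_mem, smul_eq_mul, Ideal.mul_top] at this
    exact Ideal.mem_sup_right this
  refine ⟨r, ?_⟩
  -- The limit `r` agrees with `s` in the completion of `R ⧸ a`. Exactness of completion moves the
  -- difference into the image of the completion of `a`, and finite generation of `a` identifies
  -- that image with elements of the extended ideal.
  have h0 : AdicCompletion.map (maximalIdeal R) a.mkQ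
      (AdicCompletion.mk (maximalIdeal R) R x - algebraMap R (LocalCompletion R) r) = 0 := by
    apply AdicCompletion.ext
    intro n
    change Submodule.Quotient.mk (a.mkQ (x n - r)) = 0
    rw [Submodule.Quotient.mk_eq_zero]
    apply Ideal.mkQ_mem_pow_smul_top
    rw [← neg_sub]
    exact neg_mem (hr n)
  obtain ⟨u, hu⟩ := (AdicCompletion.map_exact (I := maximalIdeal R) a.injective_subtype
    (LinearMap.exact_subtype_mkQ a) a.mkQ_surjective _).1 h0
  rw [← hu]
  clear hu
  obtain ⟨w, rfl⟩ := AdicCompletion.ofTensorProduct_surjective_of_finite (maximalIdeal R) a u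
  induction w using TensorProduct.induction_on with
  | zero => simp
  | add y z hy hz => rw [map_add, map_add]; exact add_mem hy hz
  | tmul s y =>
    rw [AdicCompletion.ofTensorProduct_tmul, map_smul, smul_eq_mul, AdicCompletion.map_of]
    exact Ideal.mul_mem_left _ _ (Ideal.mem_map_of_mem _ y.2)

/-- Modulo the extended ideal, each term can be replaced by an element of `R`; the new sequence is
Cauchy modulo `a`, and its limit in `R` serves. -/
theorem LocalCompletion.isPrecompleteModulo_map {a : Ideal R}
    (h : IsPrecompleteModulo (maximalIdeal R) a) :
    IsPrecompleteModulo (maximalIdeal (LocalCompletion R))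
      (a.map (algebraMap R (LocalCompletion R))) := by
  intro F hF
  choose f hf using fun n => LocalCompletion.exists_sub_mem_map h (F n)
  obtain ⟨r, hr⟩ := h f fun n => by
    apply LocalCompletion.mem_of_algebraMap_mem_map
    rw [LocalCompletion.map_sup_pow, map_sub]
    have e : algebraMap R (LocalCompletion R) (f (n + 1)) - algebraMap R _ (f n) =
      (F (n + 1) - F n) - (F (n + 1) - algebraMap R _ (f (n + 1))) +
        (F n - algebraMap R _ (f n)) := by ring
    rw [e]
    exact add_mem (sub_mem (hF n) (Ideal.mem_sup_left (hf (n + 1)))) (Ideal.mem_sup_left (hf n))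
  refine ⟨algebraMap R _ r, fun n => ?_⟩
  have e : algebraMap R (LocalCompletion R) r - F n =
    algebraMap R (LocalCompletion R) (r - f n) - (F n - algebraMap R _ (f n)) := by
    rw [map_sub]; ring
  rw [e]
  refine sub_mem ?_ (Ideal.mem_sup_left (hf n))
  rw [← LocalCompletion.map_sup_pow]
  exact Ideal.mem_map_of_mem _ (hr n)

theorem LocalCompletion.isNoetherian_quotient_map {a : Ideal R}
    (h : IsPrecompleteModulo (maximalIdeal R) a) :
    IsNoetherian (LocalCompletion R)
      (LocalCompletion R ⧸ a.map (algebraMap R (LocalCompletion R))) := by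
  refine isNoetherian_of_tower R (isNoetherian_of_surjective
    (Algebra.linearMap R (LocalCompletion R ⧸ a.map (algebraMap R (LocalCompletion R))))
    (LinearMap.range_eq_top.2 fun s => ?_))
  obtain ⟨s, rfl⟩ := Ideal.Quotient.mk_surjective s
  obtain ⟨r, hr⟩ := LocalCompletion.exists_sub_mem_map h s
  exact ⟨r, (Ideal.Quotient.eq.2 hr).symm⟩

theorem LocalCompletion.isMiniMax {a : Ideal R} (h : IsPrecompleteModulo (maximalIdeal R) a)
    (hT : ∀ r ∈ a, ∀ t : T, r • t = 0) (hm : IsMiniMax R T)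
    [Module (LocalCompletion R) T] [IsScalarTower R (LocalCompletion R) T] :
    IsMiniMax (LocalCompletion R) T := by
  obtain ⟨N, hN, hQ⟩ := hm
  -- Each scalar of the completion acts as some element of `R`, so `R`-submodules are stable.
  let N' : Submodule (LocalCompletion R) T :=
    { N.toAddSubmonoid with
      smul_mem' := fun s t ht => by
        obtain ⟨r, hr⟩ := LocalCompletion.exists_sub_mem_map h s
        rw [LocalCompletion.smul_eq_of_sub_mem_map hT hr]
        exact N.smul_mem r ht }
  have e : N'.restrictScalars R = N := rfl
  rw [← e] at hQ
  have hN' : IsNoetherian R N' := hN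
  refine ⟨N', isNoetherian_of_tower R hN', isArtinian_of_tower R ?_⟩
  exact isArtinian_of_linearEquiv (Submodule.Quotient.restrictScalarsEquiv R N')

/-- `R ⧸ a` maps isomorphically to the completion modulo the extended ideal, so the `R ⧸ a`-action
pulls back. In any compatible structure the extended ideal acts by zero, and modulo it every scalar
comes from `R`; hence uniqueness. -/
theorem LocalCompletion.existsUnique_module {a : Ideal R}
    (h : IsPrecompleteModulo (maximalIdeal R) a) (hT : ∀ r ∈ a, ∀ t : T, r • t = 0) :
    ∃! _inst : Module (LocalCompletion R) T, IsScalarTower R (LocalCompletion R) T := by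
  let b := a.map (algebraMap R (LocalCompletion R))
  have ht : Module.IsTorsionBySet R T a := fun x r => hT r r.2 x
  let _ : Module (R ⧸ a) T := ht.module
  let φ : R ⧸ a →+* LocalCompletion R ⧸ b :=
    Ideal.quotientMap b (algebraMap R (LocalCompletion R)) Ideal.le_comap_map
  have hφ : Function.Bijective φ := by
    refine ⟨Ideal.quotientMap_injective' (LocalCompletion.comap_map_eq a).le, fun s => ?_⟩
    obtain ⟨s, rfl⟩ := Ideal.Quotient.mk_surjective s
    obtain ⟨r, hr⟩ := LocalCompletion.exists_sub_mem_map h s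
    exact ⟨Ideal.Quotient.mk a r, (Ideal.Quotient.eq.2 hr).symm⟩
  let e := RingEquiv.ofBijective φ hφ
  let ρ : LocalCompletion R →+* R ⧸ a := e.symm.toRingHom.comp (Ideal.Quotient.mk b)
  have hρ : ∀ r : R, ρ (algebraMap R _ r) = Ideal.Quotient.mk a r := fun r =>
    e.symm_apply_eq.2 rfl
  refine ⟨Module.compHom T ρ, ?_, fun inst hinst => ?_⟩
  · let _ := Module.compHom T ρ
    refine IsScalarTower.of_algebraMap_smul fun r t => ?_
    change ρ (algebraMap R _ r) • t = r • t
    rw [hρ]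
    exact ht.mk_smul r t
  · refine Module.ext' _ _ fun s t => ?_
    obtain ⟨r, hr⟩ := LocalCompletion.exists_sub_mem_map h s
    have h1 : s • t = r • t := LocalCompletion.smul_eq_of_sub_mem_map hT hr t
    rw [h1]
    have h2 : ρ s = Ideal.Quotient.mk a r := e.symm_apply_eq.2 (Ideal.Quotient.eq.2 hr)
    change r • t = ρ s • t
    rw [h2]
    exact (ht.mk_smul r t).symm

theorem IsMiniMax.isMatlisReflexiveOverCompletion {a : Ideal R}
    (h : IsPrecompleteModulo (maximalIdeal R) a) (hT : ∀ r ∈ a, ∀ t : T, r • t = 0)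
    (hm : IsMiniMax R T) : IsMatlisReflexiveOverCompletion R T := by
  refine ⟨LocalCompletion.existsUnique_module h hT, fun {_ _} => ?_⟩
  have := LocalCompletion.isNoetherian_quotient_map h
  exact (LocalCompletion.isMiniMax h hT hm).isMatlisReflexive _
    (LocalCompletion.isPrecompleteModulo_map h)
    fun s hs t => LocalCompletion.smul_eq_zero_of_mem_map hT hs t

end Completion

/-! ### Tor through a projective resolution of the second argument -/

section Tor
open MonoidalCategory
variable {R : Type u} [CommRing R] {Z : ModuleCat.{u} R} (P : ProjectiveResolution Z)

/-- The complex `X ⊗ P` whose homology is `Tor(X, Z)`, for a projective resolution `P` of `Z`. -/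
noncomputable abbrev torComplex (X : ModuleCat.{u} R) : ChainComplex (ModuleCat.{u} R) ℕ :=
  (((tensoringLeft (ModuleCat.{u} R)).obj X).mapHomologicalComplex _).obj P.complex

/-- The map of complexes `X ⊗ P ⟶ Y ⊗ P` induced by `X ⟶ Y`. -/
noncomputable def torComplexMap {X Y : ModuleCat.{u} R} (f : X ⟶ Y) :
    torComplex P X ⟶ torComplex P Y :=
  (NatTrans.mapHomologicalComplex ((tensoringLeft (ModuleCat.{u} R)).map f) _).app P.complex

theorem torComplexMap_f_hom {X Y : ModuleCat.{u} R} (f : X ⟶ Y) (n : ℕ) :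
    ((torComplexMap P f).f n).hom = f.hom.rTensor (P.complex.X n) := rfl

theorem torComplexMap_comp {X Y W : ModuleCat.{u} R} (f : X ⟶ Y) (g : Y ⟶ W) :
    torComplexMap P (f ≫ g) = torComplexMap P f ≫ torComplexMap P g := by
  simp [torComplexMap]

theorem torComplexMap_zero (X Y : ModuleCat.{u} R) : torComplexMap P (0 : X ⟶ Y) = 0 := by
  ext n : 2
  rw [torComplexMap_f_hom]
  exact LinearMap.rTensor_zero _

theorem torComplexMap_smul {X : ModuleCat.{u} R} (r : R) :
    torComplexMap P (r • 𝟙 X) = r • 𝟙 (torComplex P X) := by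
  ext n : 2
  rw [torComplexMap_f_hom]
  simp [LinearMap.rTensor_smul]
  rfl

instance flat_projectiveResolution (n : ℕ) : Module.Flat R (P.complex.X n) :=
  have : Module.Projective R (P.complex.X n) :=
    (IsProjective.iff_projective _).2 (P.projective n)
  inferInstance

/-- The short complex `X₁ ⊗ P ⟶ X₂ ⊗ P ⟶ X₃ ⊗ P`. -/
noncomputable def torShortComplex (S : ShortComplex (ModuleCat.{u} R)) :
    ShortComplex (ChainComplex (ModuleCat.{u} R) ℕ) :=
  ShortComplex.mk (torComplexMap P S.f) (torComplexMap P S.g) (by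
    rw [← torComplexMap_comp, S.zero, torComplexMap_zero])

/-- The terms of `P` are flat, so tensoring is exact in each degree. The long exact sequences in the
first argument of Tor come from here. -/
theorem torShortComplex_shortExact {S : ShortComplex (ModuleCat.{u} R)} (hS : S.ShortExact) :
    (torShortComplex P S).ShortExact := by
  apply HomologicalComplex.shortExact_of_degreewise_shortExact
  intro n
  have hf : Function.Injective S.f.hom := (ModuleCat.mono_iff_injective _).1 hS.mono_f
  have hg : Function.Surjective S.g.hom := (ModuleCat.epi_iff_surjective _).1 hS.epi_g
  have hfg : Function.Exact S.f.hom S.g.hom :=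
    (ShortComplex.ShortExact.moduleCat_exact_iff_function_exact S).1 hS.exact
  refine ShortComplex.ShortExact.mk' ?_ ?_ ?_
  · rw [ShortComplex.ShortExact.moduleCat_exact_iff_function_exact]
    exact rTensor_exact (P.complex.X n) hfg hg
  · rw [ModuleCat.mono_iff_injective]
    exact Module.Flat.rTensor_preserves_injective_linearMap S.f.hom hf
  · rw [ModuleCat.epi_iff_surjective]
    exact LinearMap.rTensor_surjective (P.complex.X n) hg

theorem HomologicalComplex.homologyMap_smul_id (K : ChainComplex (ModuleCat.{u} R) ℕ) (r : R)
    (i : ℕ) : HomologicalComplex.homologyMap (r • 𝟙 K) i = r • 𝟙 (K.homology i) := by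
  have h := ShortComplex.homologyMap_smul (𝟙 (K.sc i)) r
  rw [ShortComplex.homologyMap_id] at h
  exact h

/-- A power of `x` kills a homology class if powers of `x` kill all chains. -/
theorem HomologicalComplex.exists_pow_smul_homology_eq_zero
    (K : ChainComplex (ModuleCat.{u} R) ℕ) (x : R) (i : ℕ)
    (h : ∀ y : K.X i, ∃ n : ℕ, x ^ n • y = 0) (t : K.homology i) : ∃ n : ℕ, x ^ n • t = 0 := by
  obtain ⟨z, rfl⟩ := (ModuleCat.epi_iff_surjective (K.homologyπ i)).1 inferInstance t
  obtain ⟨n, hn⟩ := h (K.iCycles i z)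
  refine ⟨n, ?_⟩
  rw [← map_smul] at hn ⊢
  have h0 : x ^ n • z = 0 := (ModuleCat.mono_iff_injective (K.iCycles i)).1 inferInstance
    (hn.trans (map_zero _).symm)
  rw [h0, map_zero]

theorem HomologicalComplex.smul_homology_eq_zero
    (K : ChainComplex (ModuleCat.{u} R) ℕ) (x : R) (i : ℕ)
    (h : ∀ y : K.X i, x • y = 0) (t : K.homology i) : x • t = 0 := by
  obtain ⟨z, rfl⟩ := (ModuleCat.epi_iff_surjective (K.homologyπ i)).1 inferInstance t
  have hn := h (K.iCycles i z)
  rw [← map_smul] at hn ⊢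
  have h0 : x • z = 0 := (ModuleCat.mono_iff_injective (K.iCycles i)).1 inferInstance
    (hn.trans (map_zero _).symm)
  rw [h0, map_zero]

/-- The homology of `A ⊗ P`, which is `Tor_i(A, Z)`. -/
noncomputable abbrev torHomology (i : ℕ) (A : Type u) [AddCommGroup A] [Module R A] :
    ModuleCat.{u} R :=
  (torComplex P (ModuleCat.of R A)).homology i

variable {A B C : Type u} [AddCommGroup A] [Module R A] [AddCommGroup B] [Module R B]
  [AddCommGroup C] [Module R C]

/-- The map `Tor_i(A, Z) → Tor_i(B, Z)` induced by a linear map `A → B`. -/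
noncomputable def torHomologyMap (i : ℕ) (f : A →ₗ[R] B) :
    torHomology P i A →ₗ[R] torHomology P i B :=
  (HomologicalComplex.homologyMap (torComplexMap P (ModuleCat.ofHom f)) i).hom

theorem torHomologyMap_comp (i : ℕ) (f : A →ₗ[R] B) (g : B →ₗ[R] C) :
    torHomologyMap P i (g ∘ₗ f) = torHomologyMap P i g ∘ₗ torHomologyMap P i f := by
  simp only [torHomologyMap, ModuleCat.ofHom_comp, torComplexMap_comp,
    HomologicalComplex.homologyMap_comp, ModuleCat.hom_comp]

theorem torHomologyMap_lsmul (i : ℕ) (r : R) (t : torHomology P i A) :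
    torHomologyMap P i (LinearMap.lsmul R A r) t = r • t := by
  have h : ModuleCat.ofHom (LinearMap.lsmul R A r) = r • 𝟙 (ModuleCat.of R A) := rfl
  rw [torHomologyMap, h, torComplexMap_smul, HomologicalComplex.homologyMap_smul_id]
  rfl

section LongExact

variable {f : A →ₗ[R] B} {g : B →ₗ[R] C} (hf : Function.Injective f)
  (hfg : Function.Exact f g) (hg : Function.Surjective g)

include hf hfg hg

theorem torShortComplex_shortExact_of_exact :
    (torShortComplex P (ShortComplex.mk (ModuleCat.ofHom f) (ModuleCat.ofHom g)
      (ModuleCat.hom_ext hfg.linearMap_comp_eq_zero))).ShortExact :=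
  torShortComplex_shortExact P <| ShortComplex.ShortExact.mk'
    ((ShortComplex.ShortExact.moduleCat_exact_iff_function_exact _).2 hfg)
    ((ModuleCat.mono_iff_injective _).2 hf) ((ModuleCat.epi_iff_surjective _).2 hg)

theorem torHomologyMap_exact (i : ℕ) :
    Function.Exact (torHomologyMap P i f) (torHomologyMap P i g) :=
  (ShortComplex.ShortExact.moduleCat_exact_iff_function_exact _).1
    ((torShortComplex_shortExact_of_exact P hf hfg hg).homology_exact₂ i)

theorem torHomology_exists_connecting (i : ℕ) :
    ∃ δ : torHomology P (i + 1) C →ₗ[R] torHomology P i A,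
      Function.Exact (torHomologyMap P (i + 1) g) δ ∧
      Function.Exact δ (torHomologyMap P i f) := by
  have h := torShortComplex_shortExact_of_exact P hf hfg hg
  exact ⟨(h.δ (i + 1) i rfl).hom,
    (ShortComplex.ShortExact.moduleCat_exact_iff_function_exact _).1
      (h.homology_exact₃ (i + 1) i rfl),
    (ShortComplex.ShortExact.moduleCat_exact_iff_function_exact _).1
      (h.homology_exact₁ (i + 1) i rfl)⟩

end LongExact

theorem torHomology_subsingleton_of_flat [Module.Flat R A] (i : ℕ) :
    Subsingleton (torHomology P (i + 1) A) := by
  have h : (torComplex P (ModuleCat.of R A)).ExactAt (i + 1) := by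
    rw [HomologicalComplex.exactAt_iff' _ (i + 2) (i + 1) i (by simp only [ChainComplex.prev]; rfl)
      (by simp)]
    have := P.exact_succ i
    rw [ShortComplex.ShortExact.moduleCat_exact_iff_function_exact] at this ⊢
    exact Module.Flat.lTensor_exact A this
  exact ModuleCat.subsingleton_of_isZero h.isZero_homology

theorem torHomology_exists_pow_smul_eq_zero (i : ℕ) {x : R}
    (h : ∀ a : A, ∃ n : ℕ, x ^ n • a = 0) (t : torHomology P i A) :
    ∃ n : ℕ, x ^ n • t = 0 := by
  refine HomologicalComplex.exists_pow_smul_homology_eq_zero _ x i (fun y => ?_) t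
  change TensorProduct R A (P.complex.X i) at y
  change ∃ n : ℕ, x ^ n • (y : TensorProduct R A (P.complex.X i)) = 0
  induction y using TensorProduct.induction_on with
  | zero => exact ⟨0, smul_zero _⟩
  | tmul a p =>
    obtain ⟨n, hn⟩ := h a
    exact ⟨n, by rw [TensorProduct.smul_tmul', hn, TensorProduct.zero_tmul]⟩
  | add y z hy hz =>
    obtain ⟨n, hn⟩ := hy
    obtain ⟨m, hm⟩ := hz
    refine ⟨n + m, ?_⟩
    have h1 : x ^ (n + m) • y = 0 := by rw [add_comm, pow_add, mul_smul, hn, smul_zero]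
    have h2 : x ^ (n + m) • z = 0 := by rw [pow_add, mul_smul, hm, smul_zero]
    rw [smul_add, h1, h2, add_zero]

theorem torHomology_smul_eq_zero (i : ℕ) {x : R}
    (h : ∀ a : A, x • a = 0) (t : torHomology P i A) : x • t = 0 := by
  refine HomologicalComplex.smul_homology_eq_zero _ x i (fun y => ?_) t
  change TensorProduct R A (P.complex.X i) at y
  change x • (y : TensorProduct R A (P.complex.X i)) = 0
  induction y using TensorProduct.induction_on with
  | zero => exact smul_zero _
  | tmul a p => rw [TensorProduct.smul_tmul', h a, TensorProduct.zero_tmul]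
  | add y z hy hz => rw [smul_add, hy, hz, add_zero]

/-- Both `r • 𝟙` and `0` on `P` lift the zero endomorphism of `Z`, so they induce the same map on
homology. -/
theorem torHomology_smul_eq_zero_right (i : ℕ) {r : R} (h : ∀ z : Z, r • z = 0)
    (t : torHomology P i A) : r • t = 0 := by
  let F := (tensoringLeft (ModuleCat.{u} R)).obj (ModuleCat.of R A)
  have hπ : r • P.π = 0 := by
    ext y
    exact h _
  have h1 := F.leftDerived_map_eq i (0 : Z ⟶ Z) (P := P) (Q := P) (r • 𝟙 P.complex) (by
    rw [CategoryTheory.Linear.smul_comp, Category.id_comp, hπ, Functor.map_zero,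
      Limits.comp_zero])
  have h2 : (F.mapHomologicalComplex (ComplexShape.down ℕ)).map (r • 𝟙 P.complex) =
      r • 𝟙 (torComplex P (ModuleCat.of R A)) := by
    rw [Functor.map_smul, CategoryTheory.Functor.map_id]
  rw [F.leftDerived_map_eq i (0 : Z ⟶ Z) (P := P) (Q := P) 0 (by simp), Functor.map_zero,
    Limits.zero_comp, Limits.comp_zero, Functor.comp_map, h2] at h1
  have h3 := (P.isoLeftDerivedObj F i).inv ≫= (h1 =≫ (P.isoLeftDerivedObj F i).hom)
  simp only [Limits.zero_comp, Limits.comp_zero, Category.assoc, Iso.inv_hom_id,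
    Category.comp_id, Iso.inv_hom_id_assoc] at h3
  have h4 : (0 : torHomology P i A ⟶ torHomology P i A) = r • 𝟙 _ :=
    h3.trans (HomologicalComplex.homologyMap_smul_id _ r i)
  exact (LinearMap.congr_fun (congrArg ModuleCat.Hom.hom h4) t).symm

end Tor

/-! ### Tor of mini-max modules -/

section MiniMaxTor

variable {R : Type u} [CommRing R] {M' : Type u} [AddCommGroup M'] [Module R M']
  (P : ProjectiveResolution (ModuleCat.of R M'))

/-- `Tor` can be computed with any projective resolution. -/
noncomputable def torModuleEquiv (i : ℕ) (A : Type u) [AddCommGroup A] [Module R A] :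
    torModule R i A M' ≃ₗ[R] torHomology P i A :=
  (P.isoLeftDerivedObj _ i).toLinearEquiv

/-- `Tor₀` is the tensor product. -/
noncomputable def torHomologyZeroEquiv (A : Type u) [AddCommGroup A] [Module R A] :
    torHomology P 0 A ≃ₗ[R] TensorProduct R A M' :=
  (torModuleEquiv P 0 A).symm ≪≫ₗ
    ((Functor.leftDerivedZeroIsoSelf ((MonoidalCategory.tensoringLeft (ModuleCat.{u} R)).obj
      (ModuleCat.of R A))).app (ModuleCat.of R M')).toLinearEquiv

/-- For finitely generated `N` the modules `Tor_i(N, M')` lie in every Serre class containing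
`M'`. -/
theorem IsSerreClass.torHomology [IsNoetherianRing R]
    {p : ∀ (M : Type u) [AddCommGroup M] [Module R M], Prop} (hp : IsSerreClass R p) (hM' : p M')
    (i : ℕ) (N : Type u) [AddCommGroup N] [Module R N] [Module.Finite R N] :
    p (torHomology P i N) := by
  induction i generalizing N with
  | zero =>
    -- A surjection `R^n → N` makes `N ⊗ M'` a quotient of `M'^n`.
    obtain ⟨n, f, hf⟩ := Module.Finite.exists_fin' R N
    let e := (torHomologyZeroEquiv P N).symm.toLinearMap ∘ₗ
      (TensorProduct.comm R M' N).toLinearMap ∘ₗ f.lTensor M' ∘ₗ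
      (TensorProduct.piScalarRight R R M' (Fin n)).symm.toLinearMap
    refine hp.of_surjective e ?_ (hp.pi_fin hM' n)
    exact (torHomologyZeroEquiv P N).symm.surjective.comp
      ((TensorProduct.comm R M' N).surjective.comp
        ((LinearMap.lTensor_surjective M' hf).comp (LinearEquiv.surjective _)))
  | succ i ih =>
    obtain ⟨n, f, hf⟩ := Module.Finite.exists_fin' R N
    -- Dimension shifting: `Tor_{i+1}(R^n, M')` vanishes, and the kernel is again finitely generated
    -- because `R` is noetherian.
    obtain ⟨δ, hδ, -⟩ := torHomology_exists_connecting P (LinearMap.ker f).injective_subtype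
      (LinearMap.exact_subtype_ker_map f) hf i
    have := torHomology_subsingleton_of_flat P (A := Fin n → R) i
    exact hp.of_exact _ δ hδ (hp.of_subsingleton _) (ih (LinearMap.ker f))

theorem torModule_smul_eq_zero {M : Type u} [AddCommGroup M] [Module R M] (i : ℕ) {r : R}
    (hr : r ∈ Module.annihilator R M + Module.annihilator R M') (t : torModule R i M M') :
    r • t = 0 := by
  let P := ProjectiveResolution.of (ModuleCat.of R M')
  apply (torModuleEquiv P i M).injective
  rw [map_smul, map_zero]
  obtain ⟨x, hx, y, hy, rfl⟩ := Submodule.mem_sup.1 hr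
  rw [add_smul, torHomology_smul_eq_zero P i (Module.mem_annihilator.1 hx),
    torHomology_smul_eq_zero_right P i (Module.mem_annihilator.1 hy), add_zero]

variable [IsNoetherianRing R] [IsLocalRing R]

/-- The list `l` holds the generators of the maximal ideal not yet known to kill `A`. Each step
moves one into `J` by passing to the kernel and cokernel of `x` on `A`; the degree must vary because
the cokernel enters one degree higher. -/
theorem isArtinian_torHomology_of_annihilated (hM' : IsMiniMax R M') (l : List R)
    (hl : ∀ x ∈ l, x ∈ maximalIdeal R) (J : Ideal R)
    (hJ : maximalIdeal R ≤ J ⊔ Ideal.span {x | x ∈ l}) (i : ℕ) (A : Type u) [AddCommGroup A]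
    [Module R A] [IsArtinian R A] (hA : ∀ r ∈ J, ∀ a : A, r • a = 0) :
    IsArtinian R (torHomology P i A) := by
  induction l generalizing J i A with
  -- Now the maximal ideal kills `A`, so `A` is also noetherian; its Tor is mini-max and killed by
  -- the maximal ideal, hence of finite length.
  | nil =>
    have hm : ∀ r ∈ maximalIdeal R, ∀ a : A, r • a = 0 := fun r hr =>
      hA r (by simpa using hJ hr)
    have : IsArtinianRing (R ⧸ maximalIdeal R) :=
      inferInstanceAs (IsArtinianRing (ResidueField R))
    have hN : IsNoetherian R A :=
      (isNoetherian_iff_isArtinian_of_annihilated (maximalIdeal R) hm).2 inferInstance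
    have h1 := (isSerreClass_isMiniMax R).torHomology P hM' i A
    have h2 := h1.isFiniteLength (maximalIdeal R) fun r hr =>
      torHomology_smul_eq_zero P i (hm r hr)
    exact (isFiniteLength_iff_isNoetherian_isArtinian.1 h2).2
  | cons x l ih =>
    have hx : x ∈ maximalIdeal R := hl x (by simp)
    let J' := J ⊔ Ideal.span {x}
    have hJ' : maximalIdeal R ≤ J' ⊔ Ideal.span {y | y ∈ l} := by
      refine hJ.trans (sup_le (le_sup_left.trans le_sup_left) ?_)
      rw [Ideal.span_le]
      rintro y hy
      rcases List.mem_cons.1 hy with rfl | hy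
      · exact Ideal.mem_sup_left (Ideal.mem_sup_right (Ideal.mem_span_singleton_self y))
      · exact Ideal.mem_sup_right (Ideal.subset_span hy)
    have key : ∀ (i : ℕ) (B : Type u) [AddCommGroup B] [Module R B] [IsArtinian R B],
        (∀ r ∈ J, ∀ b : B, r • b = 0) → (∀ b : B, x • b = 0) →
        IsArtinian R (torHomology P i B) := by
      intro i B _ _ _ h1 h2
      refine ih (fun y hy => hl y (List.mem_cons_of_mem x hy)) J' hJ' i B fun r hr b => ?_
      obtain ⟨s, hs, t, ht, rfl⟩ := Submodule.mem_sup.1 hr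
      obtain ⟨t, rfl⟩ := Ideal.mem_span_singleton'.1 ht
      rw [add_smul, h1 s hs, mul_smul, h2, smul_zero, add_zero]
    let μ := LinearMap.lsmul R A x
    let K := LinearMap.ker μ
    let I := LinearMap.range μ
    have hK := key i K (fun r hr a => Subtype.ext (hA r hr a)) (fun a => Subtype.ext a.2)
    have hQ := key (i + 1) (A ⧸ I)
      (fun r hr a => by
        obtain ⟨a, rfl⟩ := Submodule.Quotient.mk_surjective _ a
        rw [← Submodule.Quotient.mk_smul, hA r hr, Submodule.Quotient.mk_zero])
      (fun a => by
        obtain ⟨a, rfl⟩ := Submodule.Quotient.mk_surjective _ a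
        exact (Submodule.Quotient.mk_eq_zero _).2 ⟨a, rfl⟩)
    have hexact : Function.Exact K.subtype μ.rangeRestrict := fun a => by
      rw [← LinearMap.mem_ker, LinearMap.ker_rangeRestrict]
      simp [K]
    have e1 := torHomologyMap_exact P K.injective_subtype hexact μ.surjective_rangeRestrict i
    obtain ⟨δ, -, e2⟩ := torHomology_exists_connecting P I.injective_subtype
      (LinearMap.exact_subtype_mkQ I) I.mkQ_surjective i
    let ν := LinearMap.lsmul R (torHomology P i A) x
    have hν : ν = torHomologyMap P i I.subtype ∘ₗ torHomologyMap P i μ.rangeRestrict := by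
      rw [← torHomologyMap_comp, show I.subtype ∘ₗ μ.rangeRestrict = μ from rfl]
      exact LinearMap.ext fun t => (torHomologyMap_lsmul P i x t).symm
    -- Multiplication by `x` on Tor factors through `Tor_i(xA, M')`. Its kernel is an extension of a
    -- submodule of `ker (Tor_i(xA) → Tor_i(A)) = range δ` by the image of `Tor_i(K, M')`.
    have hker : IsArtinian R (LinearMap.ker ν) := by
      have hS := isSerreClass_isArtinian R
      have h1 : IsArtinian R (LinearMap.range δ) :=
        hS.of_surjective δ.rangeRestrict δ.surjective_rangeRestrict hQ
      have h2 : IsArtinian R (LinearMap.range (torHomologyMap P i K.subtype)) :=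
        hS.of_surjective _ (LinearMap.surjective_rangeRestrict _) hK
      let φ : LinearMap.range (torHomologyMap P i K.subtype) →ₗ[R] LinearMap.ker ν :=
        Submodule.inclusion (by
          rw [hν, ← e1.linearMap_ker_eq]
          exact LinearMap.ker_le_ker_comp _ _)
      let ψ : LinearMap.ker ν →ₗ[R] LinearMap.range δ :=
        ((torHomologyMap P i μ.rangeRestrict) ∘ₗ (LinearMap.ker ν).subtype).codRestrict _
          fun t => by
            rw [← e2.linearMap_ker_eq, LinearMap.mem_ker]
            exact (LinearMap.congr_fun hν t).symm.trans t.2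
      refine hS.of_exact φ ψ (fun t => ?_) h2 h1
      constructor
      · intro ht
        obtain ⟨s, hs⟩ := (e1 t).1 (congrArg Subtype.val ht)
        exact ⟨⟨t, s, hs⟩, rfl⟩
      · rintro ⟨⟨_, s, rfl⟩, rfl⟩
        exact Subtype.ext (e1.apply_apply_eq_zero s)
    exact isArtinian_of_isArtinian_ker_smul x
      (torHomology_exists_pow_smul_eq_zero P i fun a => IsArtinian.exists_pow_smul_eq_zero hx a)

/-- If `A` is artinian and `M'` is mini-max, then `Tor_i(A, M')` is artinian. -/
theorem isArtinian_torHomology (hM' : IsMiniMax R M') (i : ℕ) (A : Type u) [AddCommGroup A]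
    [Module R A] [IsArtinian R A] : IsArtinian R (torHomology P i A) := by
  obtain ⟨s, hs⟩ := (maximalIdeal R).fg_of_isNoetherianRing
  refine isArtinian_torHomology_of_annihilated P hM' s.toList ?_ ⊥ ?_ i A ?_
  · intro x hx
    rw [← hs]
    exact Submodule.subset_span (by simpa using hx)
  · rw [bot_sup_eq]
    exact hs.symm.le.trans (Submodule.span_mono fun x hx => by simpa using hx)
  · intro r hr a
    rw [(Submodule.mem_bot R).1 hr, zero_smul]

theorem IsMiniMax.torHomology (hM' : IsMiniMax R M') (i : ℕ) {M : Type u} [AddCommGroup M]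
    [Module R M] (hM : IsMiniMax R M) : IsMiniMax R (torHomology P i M) := by
  obtain ⟨N, hN, hQ⟩ := hM
  have := isArtinian_torHomology P hM' i (M ⧸ N)
  exact (isSerreClass_isMiniMax R).of_exact _ _
    (torHomologyMap_exact P N.injective_subtype (LinearMap.exact_subtype_mkQ N) N.mkQ_surjective i)
    ((isSerreClass_isMiniMax R).torHomology P hM' i N) .of_isArtinian

theorem IsMiniMax.torModule {M : Type u} [AddCommGroup M] [Module R M] (hM : IsMiniMax R M)
    (hM' : IsMiniMax R M') (i : ℕ) : IsMiniMax R (torModule R i M M') :=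
  let P := ProjectiveResolution.of (ModuleCat.of R M')
  (isSerreClass_isMiniMax R).of_injective _ (torModuleEquiv P i M).injective
    (hM'.torHomology P i hM)

end MiniMaxTor

theorem mainTheorem7 (R : Type u) [CommRing R] [IsNoetherianRing R] [IsLocalRing R]
    (M M' : Type u) [AddCommGroup M] [Module R M] [AddCommGroup M'] [Module R M']
    (hM : IsMiniMax R M) (hM' : IsMiniMax R M') (i : ℕ) :
    IsMiniMax R (torModule R i M M') ∧
    (IsCompleteQuotient R (Module.annihilator R M + Module.annihilator R M') →
      IsMatlisReflexive R (torModule R i M M') ∧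
      IsMatlisReflexiveOverCompletion R (torModule R i M M')) ∧
    (IsArtinianRing (R ⧸ (Module.annihilator R M + Module.annihilator R M')) →
      IsFiniteLength R (torModule R i M M')) := by
  have hT := hM.torModule hM' i
  have h0 : ∀ r ∈ Module.annihilator R M + Module.annihilator R M',
      ∀ t : torModule R i M M', r • t = 0 := fun r hr t => torModule_smul_eq_zero i hr t
  refine ⟨hT, fun h => ?_, fun h => hT.isFiniteLength _ h0⟩
  have hc := h.isPrecompleteModulo
  exact ⟨hT.isMatlisReflexive _ hc h0, hT.isMatlisReflexiveOverCompletion hc h0⟩
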